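/- A deterministic shared object type $T$ has a set of states, a set of operations (an operation includes its arguments), and a sequential specification that gives a unique next state and a unique response for each operation applied in each state. It is readable if it has an operation that returns the entire state of the object without altering it. Let $q_0$ be a state, $op_1,\dots,op_n$ (not necessarily distinct) operations, and $A,B$ a partition of $\{1,\dots,n\}$ into two non-empty teams. For $X\in\{A,B\}$, consider the sequences $i_1,\dots,i_\alpha$ ($\alpha\ge 1$) of distinct indices with $i_1\in X$, and perform $op_{i_1},\dots,op_{i_\alpha}$ in this order on an object of type $T$ initially in state $q_0$. Let $Q_X$ be the set of all states in which the object can end up in this way, and for each $j$ let $R_{X,j}$ be the set of pairs $(r,q)$ such that, for some such sequence that includes $j$, $op_j$ returns $r$ and the object ends up in state $q$. The type $T$ is $n$-discerning if $q_0,A,B,op_1,\dots,op_n$ can be chosen so that $R_{A,j}\cap R_{B,j}=\emptyset$ for all $j$. It is $n$-recording if they can be chosen so that (1) $Q_A\cap Q_B=\emptyset$, (2) $q_0\notin Q_A$ or $|B|=1$, and (3) $q_0\notin Q_B$ or $|A|=1$. Consider asynchronous processes that communicate by atomic operations on arbitrarily (possibly infinitely) many shared objects of type $T$ and read/write registers,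 with initial states chosen by the algorithm. In the consensus problem each process has an input; no two outputs may be different (agreement), each output must be the input of some process (validity), and each process outputs a value after finitely many of its own steps, however the steps of the processes are interleaved (wait-freedom). In recoverable consensus, each process may moreover crash at any time, independently of the others and any number of times: its local state is reset, so that it starts a new run of its algorithm from the beginning with the same input, while the shared memory is unaffected. Agreement and validity then concern all outputs of all runs, and each run must either crash or output a value after finitely many of the process's own steps. Let $cons(T)$ (respectively $rcons(T)$) be the maximum number of processes that can solve consensus (respectively recoverable consensus) using objects of type $T$ and registers, or $\infty$ if there is no maximum. Proposition. If a deterministic, readable type $T$ is 3-discerning, then it is 2-recording. Moreover, if $T$ is a deterministic, readable type with $cons(T)=3$, then $2\le rcons(T)\le 3$. -/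

import Mathlib

universe u

/-- A deterministic shared object type, given by its sequential specification: the states, the
operations (names together with arguments), the responses, and, for every state and operation,
the unique next state and the unique response. -/
structure ObjType where
  State : Type u
  Op : Type u
  Resp : Type u
  next : State → Op → State
  resp : State → Op → Resp

namespace ObjType

/-- The type has a read operation, which never changes the state and whose response determines
the entire state. -/
def Readable (T : ObjType.{u}) : Prop :=
  ∃ rd : T.Op, (∀ q, T.next q rd = q) ∧ Function.Injective fun q => T.resp q rd

variable (T : ObjType.{u}) {n : ℕ}

/-- The state reached from `q` when the operations `op i`, for `i` in the list `l`, are performed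
in the order of the list. -/
def nextList (op : Fin n → T.Op) (q : T.State) (l : List (Fin n)) : T.State :=
  l.foldl (fun q i => T.next q (op i)) q

/-- The set `R_{X,j}` of pairs `(r, q)` for which there is a sequence of distinct indices that
starts in `X` and contains `j` (it is written as `l₁`, then `j`, then `l₂`) such that performing
the corresponding operations from `q₀` makes `op j` return `r` and leaves the object in `q`. -/
def discernSet (q₀ : T.State) (op : Fin n → T.Op) (X : Finset (Fin n)) (j : Fin n) :
    Set (T.Resp × T.State) :=
  {p | ∃ l₁ l₂ : List (Fin n), (l₁ ++ j :: l₂).Nodup ∧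
    (∃ i ∈ X, (l₁ ++ j :: l₂).head? = some i) ∧
    p.1 = T.resp (T.nextList op q₀ l₁) (op j) ∧
    p.2 = T.nextList op q₀ (l₁ ++ j :: l₂)}

/-- The set `Q_X` of states that can be reached from `q₀` by a sequence of operations with
distinct indices, the first of which is in `X`. -/
def recordSet (q₀ : T.State) (op : Fin n → T.Op) (X : Finset (Fin n)) : Set T.State :=
  {q | ∃ l : List (Fin n), l.Nodup ∧ (∃ i ∈ X, l.head? = some i) ∧ q = T.nextList op q₀ l}

/-- `A` and `B` are two non-empty teams that partition the `n` participants. -/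
def IsTeams (A B : Finset (Fin n)) : Prop :=
  A.Nonempty ∧ B.Nonempty ∧ Disjoint A B ∧ A ∪ B = Finset.univ

/-- The property of being `n`-discerning. -/
def Discerning (n : ℕ) : Prop :=
  ∃ (q₀ : T.State) (A B : Finset (Fin n)) (op : Fin n → T.Op), IsTeams A B ∧
    ∀ j, T.discernSet q₀ op A j ∩ T.discernSet q₀ op B j = ∅

/-- The property of being `n`-recording. -/
def Recording (n : ℕ) : Prop :=
  ∃ (q₀ : T.State) (A B : Finset (Fin n)) (op : Fin n → T.Op), IsTeams A B ∧
    T.recordSet q₀ op A ∩ T.recordSet q₀ op B = ∅ ∧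
    (q₀ ∉ T.recordSet q₀ op A ∨ B.card = 1) ∧
    (q₀ ∉ T.recordSet q₀ op B ∨ A.card = 1)

end ObjType

/-- What an algorithm does in a given local state: it has returned an output (and halts), or its
next step is one atomic access to an object of type `T` or to a read/write register, after which
the local state depends on the response. -/
inductive Instr (T : ObjType.{u}) (Obj Reg RegVal Local V : Type u) : Type u where
  | output (v : V)
  | access (x : Obj) (o : T.Op) (k : T.Resp → Local)
  | read (r : Reg) (k : RegVal → Local)
  | write (r : Reg) (a : RegVal) (k : Local)

/-- An algorithm for `n` asynchronous sequential participants with inputs and outputs in `V`,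
which communicate through arbitrarily many objects of type `T` and arbitrarily many registers,
all with initial values chosen by the algorithm. -/
structure Algorithm (T : ObjType.{u}) (n : ℕ) (V : Type u) where
  Obj : Type u
  Reg : Type u
  RegVal : Type u
  Local : Type u
  objInit : Obj → T.State
  regInit : Reg → RegVal
  /-- The local state at the beginning of every run, for a given input. -/
  start : Fin n → V → Local
  /-- The code of each participant. -/
  code : Fin n → Local → Instr T Obj Reg RegVal Local V

/-- The events of an execution: one participant takes its next step, or it crashes (and will
restart its code from the beginning). -/
inductive Event (n : ℕ) where
  | step (p : Fin n)
  | crash (p : Fin n)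

namespace Algorithm

variable {T : ObjType.{u}} {n : ℕ} {V : Type u}

/-- A configuration: the contents of the shared memory and all local states. -/
@[ext] structure Config (alg : Algorithm T n V) where
  obj : alg.Obj → T.State
  reg : alg.Reg → alg.RegVal
  loc : Fin n → alg.Local

variable (alg : Algorithm T n V)

/-- The initial configuration for a given assignment of inputs. -/
def initConfig (inp : Fin n → V) : alg.Config where
  obj := alg.objInit
  reg := alg.regInit
  loc := fun p => alg.start p (inp p)

open Classical in
/-- The configuration after one event. A step of a participant that has already returned an output
has no effect. A crash resets the local state and leaves the shared memory unchanged. -/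
noncomputable def apply (inp : Fin n → V) (c : alg.Config) : Event n → alg.Config
  | .step p =>
    match alg.code p (c.loc p) with
    | .output _ => c
    | .access x o k =>
      { c with
        obj := Function.update c.obj x (T.next (c.obj x) o)
        loc := Function.update c.loc p (k (T.resp (c.obj x) o)) }
    | .read r k => { c with loc := Function.update c.loc p (k (c.reg r)) }
    | .write r a k =>
      { c with
        reg := Function.update c.reg r a
        loc := Function.update c.loc p k }
  | .crash p => { c with loc := Function.update c.loc p (alg.start p (inp p)) }

/-- The configuration at the end of a finite execution that starts in configuration `c`. -/
noncomputable def exec (inp : Fin n → V) (c : alg.Config) (es : List (Event n)) : alg.Config :=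
  es.foldl (alg.apply inp) c

/-- In configuration `c`, the current run of `p` has returned the output `v`. -/
def Outputs (c : alg.Config) (p : Fin n) (v : V) : Prop :=
  alg.code p (c.loc p) = .output v

/-- Agreement, in the executions with events in `E`: no two values that are output in the same
execution are different. The two outputs may be due to different participants or to different runs
of the same participant, and `es ++ es'` extends `es`, so they may occur at different times. -/
def Agreement (E : Set (Event n)) : Prop :=
  ∀ (inp : Fin n → V) (es es' : List (Event n)), (∀ e ∈ es ++ es', e ∈ E) →
    ∀ (p p' : Fin n) (v v' : V),
      alg.Outputs (alg.exec inp (alg.initConfig inp) es) p v →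
      alg.Outputs (alg.exec inp (alg.initConfig inp) (es ++ es')) p' v' → v = v'

/-- Validity, in the executions with events in `E`: each output is the input of some
participant. -/
def Validity (E : Set (Event n)) : Prop :=
  ∀ (inp : Fin n → V) (es : List (Event n)), (∀ e ∈ es, e ∈ E) →
    ∀ (p : Fin n) (v : V),
      alg.Outputs (alg.exec inp (alg.initConfig inp) es) p v → ∃ p', inp p' = v

/-- (Recoverable) wait-freedom, in the executions with events in `E`: in every infinite execution,
a participant that takes infinitely many steps and does not crash from time `t` on has returned an
output at some time `s ≥ t`. In other words, every run of the code crashes or returns an output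
after finitely many steps of its own, no matter how the others are scheduled. -/
def WaitFree (E : Set (Event n)) : Prop :=
  ∀ (inp : Fin n → V) (e : ℕ → Event n), (∀ s, e s ∈ E) →
    ∀ (p : Fin n) (t : ℕ), (∀ s, t ≤ s → e s ≠ .crash p) →
      (∀ m, ∃ s, m ≤ s ∧ e s = .step p) →
      ∃ s, t ≤ s ∧
        ∃ v, alg.Outputs (alg.exec inp (alg.initConfig inp) ((List.range s).map e)) p v

/-- The algorithm satisfies agreement, validity and (recoverable) wait-freedom in all executions
with events in `E`. -/
def SolvesUnder (E : Set (Event n)) : Prop :=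
  alg.Agreement E ∧ alg.Validity E ∧ alg.WaitFree E

/-- The algorithm solves consensus: in the executions without crash events. A participant that
halts is one that takes only finitely many steps. -/
def SolvesConsensus : Prop := alg.SolvesUnder (Set.range Event.step)

/-- The algorithm solves recoverable consensus, with independent crashes. -/
def SolvesRC : Prop := alg.SolvesUnder Set.univ

end Algorithm

namespace ObjType

/-- Consensus among `n` participants, for every set of input values, can be solved with objects of
type `T` and registers. -/
def CanSolveConsensus (T : ObjType.{u}) (n : ℕ) : Prop :=
  ∀ V : Type u, ∃ alg : Algorithm T n V, alg.SolvesConsensus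

/-- Recoverable consensus among `n` participants, for every set of input values, can be solved with
objects of type `T` and registers. -/
def CanSolveRC (T : ObjType.{u}) (n : ℕ) : Prop :=
  ∀ V : Type u, ∃ alg : Algorithm T n V, alg.SolvesRC

/-- The consensus number of `T`: the maximum number of participants that can solve consensus, or
`⊤` if there is no maximum. -/
noncomputable def cons (T : ObjType.{u}) : ℕ∞ :=
  ⨆ n ∈ {n : ℕ | T.CanSolveConsensus n}, (n : ℕ∞)

/-- The (independent) recoverable consensus number of `T`. -/
noncomputable def rcons (T : ObjType.{u}) : ℕ∞ :=
  ⨆ n ∈ {n : ℕ | T.CanSolveRC n}, (n : ℕ∞)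

end ObjType

/-! Three arguments combine. First, take `a` and `b` from opposite teams of a 3-discerning witness
and let `c` be the third index. If `op a` and `op b` could reach a common state from executions
starting with either one, applying `op c` there would return the same response and leave the same
state on both sides, so `R_{A,c}` and `R_{B,c}` would meet. Hence `op a` and `op b` are 2-recording
with singleton teams, for which conditions (2) and (3) are immediate (`Discerning.recording_two`).

Second, a valency argument shows that solving consensus forces discerning
(`CanSolveConsensus.discerning`): in a critical configuration everybody is about to access one
object, the teams are given by the decisions that the first steps force, and a common element of
`R_{A,j}` and `R_{B,j}` would make two configurations with opposite decisions look alike to `j`.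

Third, a readable 2-recording type solves recoverable consensus for two participants
(`RecoverablePair.solvesRC`). The object records who moved first, except that it may return to its
initial state; the operations are assigned so that this happens only on one side, and participant 1
yields there. The correctness proof is an invariant with three phases: undecided, and decided for
either input.

Thus `cons = 3` gives `2 ≤ rcons`. The upper bound holds because crash-free executions are among all
executions. -/

namespace ObjType

variable {T : ObjType.{u}}

/-! ### From 3-discerning to 2-recording. -/

/-- Two operations of opposite teams witness the property of being `2`-recording: a state that both
teams could reach would extend, by the operation of the third participant, to a response and a state
that both teams could reach. -/
theorem Discerning.recording_two (h : T.Discerning 3) : T.Recording 2 := by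
  obtain ⟨q₀, A, B, op, ⟨⟨a, ha⟩, ⟨b, hb⟩, hAB, -⟩, hR⟩ := h
  have hab : a ≠ b := fun e => Finset.disjoint_left.mp hAB ha (e ▸ hb)
  obtain ⟨c, hca, hcb⟩ : ∃ c : Fin 3, c ≠ a ∧ c ≠ b :=
    (by decide : ∀ a b : Fin 3, ∃ c, c ≠ a ∧ c ≠ b) a b
  have hinj : Function.Injective (![a, b] : Fin 2 → Fin 3) := by
    intro i j hij
    fin_cases i <;> fin_cases j <;> simp_all [eq_comm]
  have hc : ∀ i, (![a, b] : Fin 2 → Fin 3) i ≠ c := by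
    intro i; fin_cases i <;> simp [hca.symm, hcb.symm]
  -- Since `c` comes last, the team of a sequence is that of its first element, whichever team `c`
  -- belongs to.
  have key : ∀ (i : Fin 2) (X : Finset (Fin 3)), (![a, b] : Fin 2 → Fin 3) i ∈ X →
      ∀ q ∈ T.recordSet q₀ (fun i => op ((![a, b] : Fin 2 → Fin 3) i)) {i},
        (T.resp q (op c), T.next q (op c)) ∈ T.discernSet q₀ op X c := by
    rintro i X hi q ⟨l, hl, ⟨i', hi', hhead⟩, rfl⟩
    obtain rfl := Finset.mem_singleton.mp hi'
    have hmap : T.nextList op q₀ (l.map (![a, b] : Fin 2 → Fin 3)) =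
        T.nextList (fun i => op ((![a, b] : Fin 2 → Fin 3) i)) q₀ l := by
      simp [nextList, List.foldl_map]
    refine ⟨l.map (![a, b] : Fin 2 → Fin 3), [], ?_, ⟨_, hi, ?_⟩, ?_, ?_⟩
    · refine List.nodup_append.mpr ⟨hl.map hinj, by simp, ?_⟩
      intro x hx y hy
      obtain ⟨j, -, rfl⟩ := List.mem_map.mp hx
      obtain rfl : y = c := by simpa using hy
      exact hc j
    · cases l with
      | nil => simp at hhead
      | cons j l => simp at hhead; simp [hhead]
    · rw [hmap]
    · rw [← hmap]; simp [nextList]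
  refine ⟨q₀, {0}, {1}, fun i => op ((![a, b] : Fin 2 → Fin 3) i), ?_, ?_, by simp, by simp⟩
  · refine ⟨by simp, by simp, by simp, by decide⟩
  · rw [Set.eq_empty_iff_forall_notMem]
    rintro q ⟨h0, h1⟩
    exact (Set.eq_empty_iff_forall_notMem.mp (hR c)) _
      ⟨key 0 A (by simpa using ha) q h0, key 1 B (by simpa using hb) q h1⟩

end ObjType

/-! ### Single events and executions. -/

namespace Algorithm

variable {T : ObjType.{u}} {n : ℕ} {V : Type u} {alg : Algorithm T n V}

section Steps

variable {inp : Fin n → V} {c : alg.Config} {p : Fin n}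

theorem apply_step_output {v : V} (h : alg.code p (c.loc p) = .output v) :
    alg.apply inp c (.step p) = c := by
  simp [apply, h]

theorem apply_step_access {x : alg.Obj} {o : T.Op} {k : T.Resp → alg.Local}
    (h : alg.code p (c.loc p) = .access x o k) :
    (alg.apply inp c (.step p)).obj
        = (open Classical in Function.update c.obj x (T.next (c.obj x) o)) ∧
      (alg.apply inp c (.step p)).reg = c.reg ∧
      (alg.apply inp c (.step p)).loc = Function.update c.loc p (k (T.resp (c.obj x) o)) := by
  simp only [apply, h, true_and]

theorem apply_step_read {r : alg.Reg} {k : alg.RegVal → alg.Local}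
    (h : alg.code p (c.loc p) = .read r k) :
    (alg.apply inp c (.step p)).obj = c.obj ∧ (alg.apply inp c (.step p)).reg = c.reg ∧
      (alg.apply inp c (.step p)).loc = Function.update c.loc p (k (c.reg r)) := by
  simp only [apply, h, true_and]

theorem apply_step_write {r : alg.Reg} {a : alg.RegVal} {k : alg.Local}
    (h : alg.code p (c.loc p) = .write r a k) :
    (alg.apply inp c (.step p)).obj = c.obj ∧
      (alg.apply inp c (.step p)).reg = (open Classical in Function.update c.reg r a) ∧
      (alg.apply inp c (.step p)).loc = Function.update c.loc p k := by
  simp only [apply, h, true_and]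

theorem apply_crash :
    (alg.apply inp c (.crash p)).obj = c.obj ∧ (alg.apply inp c (.crash p)).reg = c.reg ∧
      (alg.apply inp c (.crash p)).loc = Function.update c.loc p (alg.start p (inp p)) := by
  simp only [apply, true_and]

theorem apply_step_loc_of_ne {q : Fin n} (h : q ≠ p) :
    (alg.apply inp c (.step p)).loc q = c.loc q := by
  cases hc : alg.code p (c.loc p) with
  | output v => rw [apply_step_output hc]
  | access x o k => simp [(apply_step_access (inp := inp) hc).2.2, h]
  | read r k => simp [(apply_step_read (inp := inp) hc).2.2, h]
  | write r a k => simp [(apply_step_write (inp := inp) hc).2.2, h]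

theorem apply_crash_loc_of_ne {q : Fin n} (h : q ≠ p) :
    (alg.apply inp c (.crash p)).loc q = c.loc q := by
  simp [apply_crash.2.2, h]

end Steps

theorem exec_append (inp : Fin n → V) (c : alg.Config) (es es' : List (Event n)) :
    alg.exec inp c (es ++ es') = alg.exec inp (alg.exec inp c es) es' := by
  simp [exec]

theorem SolvesUnder.mono {E E' : Set (Event n)} (h : alg.SolvesUnder E) (hE : E' ⊆ E) :
    alg.SolvesUnder E' :=
  ⟨fun inp es es' hes => h.1 inp es es' fun e he => hE (hes e he),
    fun inp es hes => h.2.1 inp es fun e he => hE (hes e he),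
    fun inp e he => h.2.2 inp e fun s => hE (he s)⟩

/-! ### Executions without crashes -/

/-- The configuration reached from `c` when participants take steps in the order of the list. -/
noncomputable def run (alg : Algorithm T n V) (inp : Fin n → V) (c : alg.Config)
    (l : List (Fin n)) : alg.Config :=
  alg.exec inp c (l.map Event.step)

theorem run_nil (inp : Fin n → V) (c : alg.Config) : alg.run inp c [] = c := rfl

theorem run_cons (inp : Fin n → V) (c : alg.Config) (p : Fin n) (l : List (Fin n)) :
    alg.run inp c (p :: l) = alg.run inp (alg.apply inp c (.step p)) l := rfl

theorem run_append (inp : Fin n → V) (c : alg.Config) (l l' : List (Fin n)) :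
    alg.run inp c (l ++ l') = alg.run inp (alg.run inp c l) l' := by
  simp [run, exec]

/-- Inputs influence transitions only through crashes. This allows comparing executions with
different inputs once the local states agree. -/
theorem run_inp (inp inp' : Fin n → V) (c : alg.Config) (l : List (Fin n)) :
    alg.run inp c l = alg.run inp' c l := by
  induction l generalizing c with
  | nil => rfl
  | cons p l ih => rw [run_cons, run_cons, ih]; rfl

/-- Participant `p` cannot distinguish the two configurations. -/
def Indist (p : Fin n) (c c' : alg.Config) : Prop :=
  c.obj = c'.obj ∧ c.reg = c'.reg ∧ c.loc p = c'.loc p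

theorem Indist.apply_step {p : Fin n} {c c' : alg.Config} (h : Indist p c c')
    (inp : Fin n → V) :
    Indist p (alg.apply inp c (.step p)) (alg.apply inp c' (.step p)) := by
  obtain ⟨ho, hr, hl⟩ := h
  cases hc : alg.code p (c.loc p) with
  | output v =>
    rw [apply_step_output hc, apply_step_output (hl ▸ hc)]
    exact ⟨ho, hr, hl⟩
  | access x o k =>
    obtain ⟨h1, h2, h3⟩ := apply_step_access (inp := inp) hc
    obtain ⟨h1', h2', h3'⟩ := apply_step_access (inp := inp) (hl ▸ hc)
    simp [Indist, h1, h2, h3, h1', h2', h3', ho, hr]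
  | read r k =>
    obtain ⟨h1, h2, h3⟩ := apply_step_read (inp := inp) hc
    obtain ⟨h1', h2', h3'⟩ := apply_step_read (inp := inp) (hl ▸ hc)
    simp [Indist, h1, h2, h3, h1', h2', h3', ho, hr]
  | write r a k =>
    obtain ⟨h1, h2, h3⟩ := apply_step_write (inp := inp) hc
    obtain ⟨h1', h2', h3'⟩ := apply_step_write (inp := inp) (hl ▸ hc)
    simp [Indist, h1, h2, h3, h1', h2', h3', ho, hr]

theorem Indist.run_replicate {p : Fin n} {c c' : alg.Config} (h : Indist p c c')
    (inp : Fin n → V) (m : ℕ) :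
    Indist p (alg.run inp c (List.replicate m p)) (alg.run inp c' (List.replicate m p)) := by
  induction m generalizing c c' with
  | zero => exact h
  | succ m ih => exact ih (h.apply_step inp)

/-- `c` is reached from the initial configuration by an execution without crashes. -/
def Reachable (inp : Fin n → V) (c : alg.Config) : Prop :=
  ∃ l, c = alg.run inp (alg.initConfig inp) l

theorem reachable_init (inp : Fin n → V) : Reachable inp (alg.initConfig inp) := ⟨[], rfl⟩

theorem Reachable.run {inp : Fin n → V} {c : alg.Config} (h : Reachable inp c)
    (l : List (Fin n)) : Reachable inp (alg.run inp c l) := by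
  obtain ⟨l', rfl⟩ := h
  exact ⟨l' ++ l, (run_append _ _ _ _).symm⟩

theorem Reachable.step {inp : Fin n → V} {c : alg.Config} (h : Reachable inp c)
    (p : Fin n) : Reachable inp (alg.apply inp c (.step p)) :=
  h.run [p]

/-- The values that are output in some execution without crashes from `c`. -/
def valence (inp : Fin n → V) (c : alg.Config) : Set V :=
  {v | ∃ l p, alg.Outputs (alg.run inp c l) p v}

theorem valence_run_subset (inp : Fin n → V) (c : alg.Config) (l : List (Fin n)) :
    valence inp (alg.run inp c l) ⊆ valence inp c := by
  rintro v ⟨l', q, h⟩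
  exact ⟨l ++ l', q, by rwa [run_append]⟩

section Solves

variable {inp : Fin n → V} {c : alg.Config}

theorem SolvesConsensus.eq_of_outputs (hs : alg.SolvesConsensus) (hc : Reachable inp c)
    {p : Fin n} {v w : V}
    (hv : alg.Outputs c p v) (hw : w ∈ valence inp c) : v = w := by
  obtain ⟨l, rfl⟩ := hc
  obtain ⟨l', q, hq⟩ := hw
  refine hs.1 inp (l.map .step) (l'.map .step) ?_ p q v w hv ?_
  · intro e he
    rw [← List.map_append] at he
    obtain ⟨i, -, rfl⟩ := List.mem_map.mp he
    exact ⟨i, rfl⟩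
  · rwa [exec_append]

theorem SolvesConsensus.exists_eq_of_mem_valence (hs : alg.SolvesConsensus) {v : V}
    (hv : v ∈ valence inp (alg.initConfig inp)) : ∃ p, inp p = v := by
  obtain ⟨l, q, hq⟩ := hv
  refine hs.2.1 inp (l.map .step) ?_ q v hq
  intro e he
  obtain ⟨i, -, rfl⟩ := List.mem_map.mp he
  exact ⟨i, rfl⟩

theorem SolvesConsensus.exists_outputs_solo (hs : alg.SolvesConsensus) (hc : Reachable inp c)
    (p : Fin n) :
    ∃ m v, alg.Outputs (alg.run inp c (List.replicate m p)) p v := by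
  obtain ⟨l, rfl⟩ := hc
  -- The schedule follows `l`; the default value of `getD` then lets `p` run alone forever.
  obtain ⟨s, hs1, v, hv⟩ := hs.2.2 inp (fun s => .step (l.getD s p)) (fun s => ⟨_, rfl⟩) p l.length
    (fun s _ => by simp) (fun m => ⟨max m l.length, le_max_left _ _, by simp⟩)
  refine ⟨s - l.length, v, ?_⟩
  have : (List.range s).map (fun s => Event.step (l.getD s p)) =
      (l ++ List.replicate (s - l.length) p).map Event.step := by
    apply List.ext_getElem
    · simp; omega
    · intro i h1 h2
      simp only [List.getElem_map, List.getElem_range, List.getElem_append]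
      split_ifs with h
      · simp [h]
      · simp [not_lt.mp h]
  rw [this] at hv
  rwa [← run_append]

/-- Let `p` run alone from both configurations: it terminates by wait-freedom and sees the same
responses, so it outputs the same value. -/
theorem SolvesConsensus.exists_mem_valence_of_indist (hs : alg.SolvesConsensus)
    (hc : Reachable inp c) {inp' : Fin n → V} {c' : alg.Config} {p : Fin n} (h : Indist p c c') :
    ∃ v, v ∈ valence inp c ∧ v ∈ valence inp' c' := by
  obtain ⟨m, v, hv⟩ := hs.exists_outputs_solo hc p
  refine ⟨v, ⟨_, _, hv⟩, ⟨List.replicate m p, p, ?_⟩⟩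
  rw [run_inp inp' inp]
  have := (h.run_replicate inp m).2.2
  rw [Outputs] at hv ⊢
  rwa [← this]

end Solves

/-! ### Bivalent and critical configurations. -/

section Binary

variable {alg : Algorithm T n (ULift.{u} Bool)}

/-- Both outputs are still possible after `c`. -/
def Bivalent (inp : Fin n → ULift.{u} Bool) (c : alg.Config) : Prop :=
  Reachable inp c ∧ ∀ b, b ∈ valence inp c

variable {inp : Fin n → ULift.{u} Bool} {c : alg.Config}

theorem SolvesConsensus.not_outputs_of_bivalent (hs : alg.SolvesConsensus)
    (hc : Bivalent inp c) {p : Fin n} {v : ULift.{u} Bool} : ¬ alg.Outputs c p v := fun h => by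
  have h1 := hs.eq_of_outputs hc.1 h (hc.2 ⟨true⟩)
  have h2 := hs.eq_of_outputs hc.1 h (hc.2 ⟨false⟩)
  simp [h1] at h2

/-- With mixed inputs, each `p` cannot tell that the others do not share its input. Running alone it
must therefore output its own input, by validity for the constant assignment. -/
theorem SolvesConsensus.exists_bivalent (hs : alg.SolvesConsensus) (hn : 2 ≤ n) :
    ∃ inp, Bivalent inp (alg.initConfig inp) := by
  let p₀ : Fin n := ⟨0, by omega⟩
  let p₁ : Fin n := ⟨1, by omega⟩
  have hne : p₁ ≠ p₀ := by simp [p₀, p₁]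
  let inp : Fin n → ULift.{u} Bool := fun p => ⟨decide (p = p₀)⟩
  have key : ∀ p, inp p ∈ valence inp (alg.initConfig inp) := by
    intro p
    obtain ⟨v, hv, hv'⟩ := hs.exists_mem_valence_of_indist (reachable_init inp)
      (inp' := fun _ => inp p) (c' := alg.initConfig fun _ => inp p) (p := p) ⟨rfl, rfl, rfl⟩
    obtain ⟨_, rfl⟩ := hs.exists_eq_of_mem_valence hv'
    exact hv
  refine ⟨inp, reachable_init _, ?_⟩
  rintro ⟨_ | _⟩
  · simpa [inp, hne] using key p₁
  · simpa [inp] using key p₀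

/-- Otherwise bivalence could be preserved forever. Some participant would take infinitely many
steps and output a value by wait-freedom, but agreement excludes outputs in bivalent configurations.
-/
theorem SolvesConsensus.exists_critical (hs : alg.SolvesConsensus) (hn : 2 ≤ n) :
    ∃ inp, ∃ c : alg.Config, Bivalent inp c ∧
      ∀ p, ¬ Bivalent inp (alg.apply inp c (.step p)) := by
  obtain ⟨inp, h₀⟩ := hs.exists_bivalent hn
  refine ⟨inp, ?_⟩
  by_contra! hcon
  have : Nonempty (Fin n) := ⟨⟨0, by omega⟩⟩
  choose! f hf using hcon
  let cfg : ℕ → alg.Config := fun k =>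
    Nat.rec (alg.initConfig inp) (fun _ c => alg.apply inp c (.step (f c))) k
  have hbiv : ∀ k, Bivalent inp (cfg k) := by
    intro k
    induction k with
    | zero => exact h₀
    | succ k ih => exact hf _ ih
  let e : ℕ → Event n := fun k => .step (f (cfg k))
  have hexec : ∀ k, alg.exec inp (alg.initConfig inp) ((List.range k).map e) = cfg k := by
    intro k
    induction k with
    | zero => rfl
    | succ k ih => rw [List.range_succ, List.map_append, exec_append, ih]; rfl
  obtain ⟨p, hp⟩ := Finite.exists_infinite_fiber fun k => f (cfg k)
  obtain ⟨s, -, v, hv⟩ := hs.2.2 inp e (fun s => ⟨_, rfl⟩) p 0 (fun s _ => by simp [e]) (fun m => by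
    obtain ⟨s, hs, hms⟩ := (Set.infinite_coe_iff.mp hp).exists_gt m
    exact ⟨s, hms.le, congrArg Event.step hs⟩)
  rw [hexec] at hv
  exact hs.not_outputs_of_bivalent (hbiv s) hv

/-- In a critical configuration, steps that lead to different decisions are accesses to the same
object. -/
theorem SolvesConsensus.exists_access_of_critical (hs : alg.SolvesConsensus)
    (hc : Bivalent inp c) {p q : Fin n} (hpq : p ≠ q)
    (hsep : ∀ (l l' : List (Fin n)) (z : Fin n),
      ¬ Indist z (alg.run inp c (p :: l)) (alg.run inp c (q :: l'))) :
    ∃ x o k o' k', alg.code p (c.loc p) = .access x o k ∧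
      alg.code q (c.loc q) = .access x o' k' := by
  have hq : alg.code q ((alg.apply inp c (.step p)).loc q) = alg.code q (c.loc q) := by
    rw [apply_step_loc_of_ne hpq.symm]
  have hp : alg.code p ((alg.apply inp c (.step q)).loc p) = alg.code p (c.loc p) := by
    rw [apply_step_loc_of_ne hpq]
  -- These are the three ways to merge the branches: `q` does not notice the step of `p` (a read, or
  -- a write that `q` overwrites), `p` does not notice a read by `q`, or the two steps commute. Only
  -- two accesses to the same object escape all three.
  have s1 := hsep [q] [] q
  have s2 := hsep [] [p] p
  have s3 := hsep [q] [p] q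
  simp only [run_cons, run_nil, Indist] at s1 s2 s3
  cases hcp : alg.code p (c.loc p) with
  | output v => exact (hs.not_outputs_of_bivalent hc hcp).elim
  | read r k =>
    exfalso
    obtain ⟨a1, a2, a3⟩ := apply_step_read (inp := inp) hcp
    cases hcq : alg.code q (c.loc q) with
    | output v => exact (hs.not_outputs_of_bivalent hc hcq).elim
    | read r' k' =>
      obtain ⟨b1, b2, b3⟩ := apply_step_read (inp := inp) hcq
      obtain ⟨d1, d2, d3⟩ := apply_step_read (inp := inp) (hq.trans hcq)
      exact s1 (by simp [*])
    | write r' a' k' =>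
      obtain ⟨b1, b2, b3⟩ := apply_step_write (inp := inp) hcq
      obtain ⟨d1, d2, d3⟩ := apply_step_write (inp := inp) (hq.trans hcq)
      exact s1 (by simp [*])
    | access x o k' =>
      obtain ⟨b1, b2, b3⟩ := apply_step_access (inp := inp) hcq
      obtain ⟨d1, d2, d3⟩ := apply_step_access (inp := inp) (hq.trans hcq)
      exact s1 (by simp [*])
  | write r a k =>
    exfalso
    obtain ⟨a1, a2, a3⟩ := apply_step_write (inp := inp) hcp
    cases hcq : alg.code q (c.loc q) with
    | output v => exact (hs.not_outputs_of_bivalent hc hcq).elim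
    | read r' k' =>
      obtain ⟨b1, b2, b3⟩ := apply_step_read (inp := inp) hcq
      obtain ⟨d1, d2, d3⟩ := apply_step_write (inp := inp) (hp.trans hcp)
      exact s2 (by simp [*])
    | write r' a' k' =>
      obtain ⟨b1, b2, b3⟩ := apply_step_write (inp := inp) hcq
      obtain ⟨d1, d2, d3⟩ := apply_step_write (inp := inp) (hq.trans hcq)
      obtain ⟨e1, e2, e3⟩ := apply_step_write (inp := inp) (hp.trans hcp)
      by_cases hr : r = r'
      · subst hr
        exact s1 (by simp [*])
      · refine s3 ⟨by simp [*], ?_, by simp [*, hpq.symm]⟩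
        classical
        rw [d2, a2, e2, b2, Function.update_comm hr]
    | access x o k' =>
      obtain ⟨b1, b2, b3⟩ := apply_step_access (inp := inp) hcq
      obtain ⟨d1, d2, d3⟩ := apply_step_access (inp := inp) (hq.trans hcq)
      obtain ⟨e1, e2, e3⟩ := apply_step_write (inp := inp) (hp.trans hcp)
      exact s3 (by simp [*, hpq.symm])
  | access x o k =>
    obtain ⟨a1, a2, a3⟩ := apply_step_access (inp := inp) hcp
    cases hcq : alg.code q (c.loc q) with
    | output v => exact (hs.not_outputs_of_bivalent hc hcq).elim
    | read r' k' =>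
      obtain ⟨b1, b2, b3⟩ := apply_step_read (inp := inp) hcq
      obtain ⟨d1, d2, d3⟩ := apply_step_access (inp := inp) (hp.trans hcp)
      exact (s2 (by simp [*])).elim
    | write r' a' k' =>
      obtain ⟨b1, b2, b3⟩ := apply_step_write (inp := inp) hcq
      obtain ⟨d1, d2, d3⟩ := apply_step_write (inp := inp) (hq.trans hcq)
      obtain ⟨e1, e2, e3⟩ := apply_step_access (inp := inp) (hp.trans hcp)
      exact (s3 (by simp [*, hpq.symm])).elim
    | access y o' k' =>
      by_cases hxy : x = y
      · subst hxy
        exact ⟨x, o, k, o', k', rfl, rfl⟩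
      · obtain ⟨b1, b2, b3⟩ := apply_step_access (inp := inp) hcq
        obtain ⟨d1, d2, d3⟩ := apply_step_access (inp := inp) (hq.trans hcq)
        obtain ⟨e1, e2, e3⟩ := apply_step_access (inp := inp) (hp.trans hcp)
        refine (s3 ⟨?_, by simp [*], ?_⟩).elim
        · classical
          rw [d1, a1, e1, b1, Function.update_of_ne (Ne.symm hxy), Function.update_of_ne hxy,
            Function.update_comm hxy]
        · simp [*, hpq.symm, Ne.symm hxy]

end Binary

/-- The effect of steps of distinct participants that are all about to access the same object. -/
theorem run_access {inp : Fin n → V} {x : alg.Obj} {op : Fin n → T.Op}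
    {k : Fin n → T.Resp → alg.Local} (l : List (Fin n)) (hl : l.Nodup) (c : alg.Config)
    (hc : ∀ i ∈ l, alg.code i (c.loc i) = .access x (op i) (k i)) :
    (alg.run inp c l).obj
        = (open Classical in Function.update c.obj x (T.nextList op (c.obj x) l)) ∧
      (alg.run inp c l).reg = c.reg ∧ ∀ i ∉ l, (alg.run inp c l).loc i = c.loc i := by
  induction l generalizing c with
  | nil => simp [run_nil, ObjType.nextList]
  | cons j l ih =>
    obtain ⟨hj, hl⟩ := List.nodup_cons.mp hl
    obtain ⟨a1, a2, a3⟩ := apply_step_access (inp := inp) (hc j (by simp))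
    obtain ⟨b1, b2, b3⟩ := ih hl (alg.apply inp c (.step j)) (fun i hi => by
      rw [apply_step_loc_of_ne (ne_of_mem_of_not_mem hi hj)]
      exact hc i (by simp [hi]))
    rw [run_cons]
    refine ⟨?_, b2.trans a2, ?_⟩
    · rw [b1, a1]
      simp [ObjType.nextList]
    · intro i hi
      rw [List.mem_cons, not_or] at hi
      rw [b3 i hi.2, apply_step_loc_of_ne hi.1]

end Algorithm

/-! ### Consensus requires a discerning type. -/

namespace ObjType

variable {T : ObjType.{u}} {n : ℕ}

open Algorithm in
/-- Solving consensus requires a discerning type: in a critical configuration all participants are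
about to access the same object, and their operations are discerning for its state. -/
theorem CanSolveConsensus.discerning (h : T.CanSolveConsensus n) (hn : 2 ≤ n) :
    T.Discerning n := by
  classical
  obtain ⟨alg, hs⟩ := h (ULift.{u} Bool)
  obtain ⟨inp, c, hc, hcrit⟩ := hs.exists_critical hn
  let A : Finset (Fin n) := {p | ⟨true⟩ ∈ valence inp (alg.apply inp c (.step p))}
  let B : Finset (Fin n) := {p | ⟨true⟩ ∉ valence inp (alg.apply inp c (.step p))}
  have hstep : ∀ b, ∃ p, b ∈ valence inp (alg.apply inp c (.step p)) := by
    intro b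
    obtain ⟨l, q, hq⟩ := hc.2 b
    cases l with
    | nil => exact (hs.not_outputs_of_bivalent hc hq).elim
    | cons p l => exact ⟨p, l, q, hq⟩
  have hex : ∀ p, ¬ (⟨true⟩ ∈ valence inp (alg.apply inp c (.step p)) ∧
      ⟨false⟩ ∈ valence inp (alg.apply inp c (.step p))) := by
    rintro p ⟨h1, h2⟩
    refine hcrit p ⟨hc.1.step p, ?_⟩
    rintro ⟨_ | _⟩
    exacts [h2, h1]
  -- Indistinguishable configurations share a possible output, whereas by criticality no value is
  -- possible after both a step of `A` and a step of `B`.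
  have hsep : ∀ p ∈ A, ∀ q ∈ B, ∀ (l l' : List (Fin n)) (z : Fin n),
      ¬ Indist z (alg.run inp c (p :: l)) (alg.run inp c (q :: l')) := by
    intro p hp q hq l l' z hz
    obtain ⟨v, hv, hv'⟩ := hs.exists_mem_valence_of_indist (inp' := inp) (hc.1.run (p :: l)) hz
    replace hv := valence_run_subset inp (alg.apply inp c (.step p)) l hv
    replace hv' := valence_run_subset inp (alg.apply inp c (.step q)) l' hv'
    rcases v with ⟨_ | _⟩
    · exact hex p ⟨(Finset.mem_filter.mp hp).2, hv⟩
    · exact (Finset.mem_filter.mp hq).2 hv'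
  have hdisj : Disjoint A B := Finset.disjoint_filter.mpr fun p _ h1 h2 => h2 h1
  have hunion : A ∪ B = Finset.univ := Finset.filter_union_filter_not_eq _ _
  obtain ⟨p₀, hp₀⟩ : A.Nonempty := by
    obtain ⟨p, hp⟩ := hstep ⟨true⟩
    exact ⟨p, by simpa [A] using hp⟩
  obtain ⟨q₀, hq₀⟩ : B.Nonempty := by
    obtain ⟨p, hp⟩ := hstep ⟨false⟩
    exact ⟨p, by simpa [B] using fun h => hex p ⟨h, hp⟩⟩
  have hacc : ∀ p ∈ A, ∀ q ∈ B, ∃ x o k o' k', alg.code p (c.loc p) = .access x o k ∧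
      alg.code q (c.loc q) = .access x o' k' := fun p hp q hq =>
    hs.exists_access_of_critical hc (fun e => Finset.disjoint_left.mp hdisj hp (e ▸ hq))
      (hsep p hp q hq)
  obtain ⟨x, o, k, o', k', hp₀c, hq₀c⟩ := hacc p₀ hp₀ q₀ hq₀
  -- Each participant is compared with the fixed representative of the opposite team, which pins its
  -- object to `x`.
  have hall : ∀ p, ∃ o k, alg.code p (c.loc p) = .access x o k := by
    intro p
    rcases Finset.mem_union.mp (hunion ▸ Finset.mem_univ p) with hp | hp
    · obtain ⟨y, o₁, k₁, o₂, k₂, h1, h2⟩ := hacc p hp q₀ hq₀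
      obtain ⟨rfl, -, -⟩ := Instr.access.inj (hq₀c.symm.trans h2)
      exact ⟨_, _, h1⟩
    · obtain ⟨y, o₁, k₁, o₂, k₂, h1, h2⟩ := hacc p₀ hp₀ p hp
      obtain ⟨rfl, -, -⟩ := Instr.access.inj (hp₀c.symm.trans h1)
      exact ⟨_, _, h2⟩
  choose op k hopk using hall
  -- After one step each, the local state of `j` depends only on the response to its own operation.
  have hloc : ∀ (l₁ l₂ : List (Fin n)) (j : Fin n), (l₁ ++ j :: l₂).Nodup →
      (alg.run inp c (l₁ ++ j :: l₂)).loc j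
        = k j (T.resp (T.nextList op (c.obj x) l₁) (op j)) := by
    intro l₁ l₂ j hl
    have hj₁ : j ∉ l₁ := fun hj => by
      simpa using (List.nodup_append.mp hl).2.2 j hj j (by simp)
    obtain ⟨hl₁, hl₂, hd⟩ := List.nodup_append.mp hl
    obtain ⟨a1, a2, a3⟩ := run_access (inp := inp) l₁ hl₁ c fun i _ => hopk i
    rw [run_append, run_cons]
    have hcj : alg.code j ((alg.run inp c l₁).loc j) = .access x (op j) (k j) := by
      rw [a3 j hj₁, hopk]
    obtain ⟨b1, b2, b3⟩ := apply_step_access (inp := inp) hcj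
    rw [(run_access (inp := inp) (op := op) (k := k) (x := x) l₂ (List.nodup_cons.mp hl₂).2 _
      ?_).2.2 j (List.nodup_cons.mp hl₂).1, b3, a1]
    · simp
    · intro i hi
      rw [apply_step_loc_of_ne (ne_of_mem_of_not_mem hi (List.nodup_cons.mp hl₂).1), a3, hopk]
      exact fun hi₁ => hd i hi₁ i (by simp [hi]) rfl
  refine ⟨c.obj x, A, B, op, ⟨⟨p₀, hp₀⟩, ⟨q₀, hq₀⟩, hdisj, hunion⟩, fun j => ?_⟩
  rw [Set.eq_empty_iff_forall_notMem]
  rintro ⟨r, s⟩ ⟨⟨l₁, l₂, hl, ⟨i, hi, hhead⟩, hr, hs'⟩,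
    ⟨l₁', l₂', hl', ⟨i', hi', hhead'⟩, hr', hs''⟩⟩
  obtain ⟨t, ht⟩ := List.head?_eq_some_iff.mp hhead
  obtain ⟨t', ht'⟩ := List.head?_eq_some_iff.mp hhead'
  -- A common pair `(r, s)` gives both configurations object state `s`, unchanged registers and
  -- local state `k j r`, so `j` cannot separate them.
  refine hsep i hi i' hi' t t' j ?_
  rw [← ht, ← ht']
  obtain ⟨a1, a2, -⟩ := run_access (inp := inp) _ hl c fun i _ => hopk i
  obtain ⟨b1, b2, -⟩ := run_access (inp := inp) _ hl' c fun i _ => hopk i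
  refine ⟨?_, a2.trans b2.symm, ?_⟩
  · rw [a1, b1, ← hs', ← hs'']
  · rw [hloc _ _ _ hl, hloc _ _ _ hl', ← hr, ← hr']

end ObjType

/-! ### A criterion for wait-freedom. -/

namespace Algorithm

variable {T : ObjType.{u}} {n : ℕ} {V : Type u} {alg : Algorithm T n V}

/-- An algorithm is wait-free if every step of a run decreases a natural number that depends on the
local state. -/
theorem waitFree_of_rank (rank : Fin n → alg.Local → ℕ)
    (hrank : ∀ inp (c : alg.Config) p, (∃ v, alg.Outputs c p v) ∨
      rank p ((alg.apply inp c (.step p)).loc p) < rank p (c.loc p)) (E : Set (Event n)) :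
    alg.WaitFree E := by
  intro inp e _ p t hcrash hinf
  let cfg : ℕ → alg.Config := fun s =>
    alg.exec inp (alg.initConfig inp) ((List.range s).map e)
  have hcfg : ∀ s, cfg (s + 1) = alg.apply inp (cfg s) (e s) := by
    intro s
    simp only [cfg, List.range_succ, List.map_append, exec_append]
    rfl
  have hother : ∀ s, t ≤ s → e s ≠ .step p → (cfg (s + 1)).loc p = (cfg s).loc p := by
    intro s hs hne
    rw [hcfg]
    have hcr := hcrash s hs
    cases hes : e s with
    | step q => exact apply_step_loc_of_ne (fun h => hne (h ▸ hes))
    | crash q => exact apply_crash_loc_of_ne (fun h => hcr (h ▸ hes))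
  suffices h : ∀ m s, t ≤ s → rank p ((cfg s).loc p) = m →
      ∃ s', t ≤ s' ∧ ∃ v, alg.Outputs (cfg s') p v from h _ t le_rfl rfl
  intro m
  induction m using Nat.strong_induction_on with
  | _ m ih =>
    intro s hs hm
    classical
    have hex : ∃ d, e (s + d) = .step p := by
      obtain ⟨s', h1, h2⟩ := hinf s
      exact ⟨s' - s, by rwa [Nat.add_sub_cancel' h1]⟩
    -- Until the next step of `p`, its local state is frozen, so that step lowers the rank measured
    -- at time `s`.
    have hmin : ∀ d, d ≤ Nat.find hex → (cfg (s + d)).loc p = (cfg s).loc p := by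
      intro d
      induction d with
      | zero => intro; rfl
      | succ d ihd =>
        intro hd
        rw [← ihd (by omega)]
        exact hother (s + d) (by omega) (Nat.find_min hex (by omega))
    have hstep := Nat.find_spec hex
    set d := Nat.find hex
    rcases hrank inp (cfg (s + d)) p with hout | hlt
    · exact ⟨s + d, by omega, hout⟩
    · rw [← hstep, ← hcfg, hmin d le_rfl, hm] at hlt
      exact ih _ hlt (s + d + 1) (by omega) rfl

end Algorithm

/-! ### Recoverable consensus for two participants -/

namespace RecoverablePair

/-- The local states; all of them contain the input of the participant. -/
inductive Loc (V : Type u) : Type u where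
  | announce (v : V)
  | look (v : V)
  | check (v : V)
  | update (v : V)
  | decide (v : V)
  | adopt (v : V)
  | done (v : V)

open Classical in
/-- Participant `0` applies `a` and participant `1` applies `b` to an object that is initially in
state `q`, unless it finds that the object has left state `q`. Participant `1` moreover yields to
the other one if the object is in state `q` but the other one has announced its input. The decision
is the input of participant `1` if the state is one that is reached by an execution that starts
with `b`, and the input of participant `0` otherwise. -/
noncomputable def alg (T : ObjType.{u}) (q : T.State) (rd a b : T.Op) (V : Type u) :
    Algorithm T 2 V where
  Obj := PUnit
  Reg := ULift.{u} (Fin 2)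
  RegVal := Option V
  Local := Loc V
  objInit := fun _ => q
  regInit := fun _ => none
  start := fun _ v => .announce v
  code := fun p s =>
    let finish (v : V) (r : T.Resp) : Loc V :=
      if r = T.resp (T.next q b) rd ∨ r = T.resp (T.next (T.next q b) a) rd
        then (if p = 0 then .adopt v else .done v)
        else if p = 0 then .done v else .adopt v
    match s with
    | .announce v => .write ⟨p⟩ (some v) (.look v)
    | .look v => .access .unit rd fun r =>
        if r = T.resp q rd then (if p = 0 then .update v else .check v)
        else finish v r
    | .check v => .read ⟨0⟩ fun x => x.elim (.update v) .done
    | .update v => .access .unit (if p = 0 then a else b) fun _ => .decide v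
    | .decide v => .access .unit rd fun r => finish v r
    -- The default `v` never matters: by the invariants below, the other input has been announced
    -- before it can be adopted.
    | .adopt v => .read ⟨if p = 0 then 1 else 0⟩ fun x => .done (x.getD v)
    | .done v => .output v

open Algorithm

variable {T : ObjType.{u}} {q : T.State} {rd a b : T.Op} {V : Type u}

/-- The conditions on the operations that make the algorithm correct. -/
structure Valid (T : ObjType.{u}) (q : T.State) (rd a b : T.Op) : Prop where
  next_read : ∀ s, T.next s rd = s
  resp_read : ∀ s s', T.resp s rd = T.resp s' rd ↔ s = s'
  -- The state after `a` and then `b` may be `q` again; every other state reached by one or both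
  -- operations must differ from `q`.
  ne_a : q ≠ T.next q a
  ne_b : q ≠ T.next q b
  ne_ba : q ≠ T.next (T.next q b) a
  a_ne_b : T.next q a ≠ T.next q b
  a_ne_ba : T.next q a ≠ T.next (T.next q b) a
  ab_ne_b : T.next (T.next q a) b ≠ T.next q b
  ab_ne_ba : T.next (T.next q a) b ≠ T.next (T.next q b) a

/-- The state of the object. -/
def state (c : (alg T q rd a b V).Config) : T.State := c.obj PUnit.unit

/-- The input that a participant has announced. -/
def announced (c : (alg T q rd a b V).Config) (p : Fin 2) : Option V := c.reg ⟨p⟩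

/-- The local state of a participant. -/
def loc (c : (alg T q rd a b V).Config) (p : Fin 2) : Loc V := c.loc p

/-- The configuration after an event. -/
noncomputable def next (inp : Fin 2 → V) (c : (alg T q rd a b V).Config) (e : Event 2) :
    (alg T q rd a b V).Config :=
  (alg T q rd a b V).apply inp c e

section Transitions

variable {inp : Fin 2 → V} {c : (alg T q rd a b V).Config} {p : Fin 2} {v : V}

theorem step_loc_of_ne {p' : Fin 2} (h : p' ≠ p) : loc (next inp c (.step p)) p' = loc c p' :=
  apply_step_loc_of_ne h

theorem crash :
    state (next inp c (.crash p)) = state c ∧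
      (∀ i, announced (next inp c (.crash p)) i = announced c i) ∧
      ∀ p', loc (next inp c (.crash p)) p' = if p' = p then .announce (inp p) else loc c p' := by
  refine ⟨rfl, fun _ => rfl, fun p' => ?_⟩
  split_ifs with h
  · subst h
    exact (congrFun (apply_crash (inp := inp) (c := c)).2.2 p').trans (Function.update_self ..)
  · exact apply_crash_loc_of_ne h

theorem step_announce (h : loc c p = .announce v) :
    state (next inp c (.step p)) = state c ∧
      (∀ i, announced (next inp c (.step p)) i = if i = p then some v else announced c i) ∧
      loc (next inp c (.step p)) p = .look v := by
  obtain ⟨h1, h2, h3⟩ := apply_step_write (alg := alg T q rd a b V) (inp := inp) (p := p) (c := c)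
    (r := ⟨p⟩) (a := some v) (k := .look v) ((congrArg _ h).trans rfl)
  refine ⟨congrFun h1 _, fun i => (congrFun h2 _).trans ?_,
    (congrFun h3 p).trans (Function.update_self ..)⟩
  split_ifs with hi
  · subst hi
    classical exact Function.update_self ..
  · have hne : (⟨i⟩ : ULift.{u} (Fin 2)) ≠ ⟨p⟩ := fun e => hi (congrArg ULift.down e)
    classical exact Function.update_of_ne (α := (alg T q rd a b V).Reg) hne _ _

open Classical in
theorem step_look (hv : Valid T q rd a b) (h : loc c p = .look v) :
    state (next inp c (.step p)) = state c ∧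
      (∀ i, announced (next inp c (.step p)) i = announced c i) ∧
      loc (next inp c (.step p)) p =
        if state c = q then (if p = 0 then .update v else .check v)
        else if state c = T.next q b ∨ state c = T.next (T.next q b) a
          then (if p = 0 then .adopt v else .done v)
          else if p = 0 then .done v else .adopt v := by
  obtain ⟨h1, h2, h3⟩ := apply_step_access (alg := alg T q rd a b V) (inp := inp) (p := p) (c := c)
    ((congrArg _ h).trans rfl)
  refine ⟨(congrFun h1 _).trans ((Function.update_self ..).trans (hv.next_read _)),
    fun i => congrFun h2 _, (congrFun h3 p).trans ((Function.update_self ..).trans ?_)⟩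
  simp only [← hv.resp_read]
  rfl

theorem step_check (h : loc c p = .check v) :
    state (next inp c (.step p)) = state c ∧
      (∀ i, announced (next inp c (.step p)) i = announced c i) ∧
      loc (next inp c (.step p)) p = (announced c 0).elim (.update v) .done := by
  obtain ⟨h1, h2, h3⟩ := apply_step_read (alg := alg T q rd a b V) (inp := inp) (p := p) (c := c)
    ((congrArg _ h).trans rfl)
  exact ⟨congrFun h1 _, fun i => congrFun h2 _,
    (congrFun h3 p).trans (Function.update_self ..)⟩

theorem step_update (h : loc c p = .update v) :
    state (next inp c (.step p)) = T.next (state c) (if p = 0 then a else b) ∧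
      (∀ i, announced (next inp c (.step p)) i = announced c i) ∧
      loc (next inp c (.step p)) p = .decide v := by
  obtain ⟨h1, h2, h3⟩ := apply_step_access (alg := alg T q rd a b V) (inp := inp) (p := p) (c := c)
    ((congrArg _ h).trans rfl)
  classical
  exact ⟨(congrFun h1 _).trans (Function.update_self ..), fun i => congrFun h2 _,
    (congrFun h3 p).trans (Function.update_self ..)⟩

open Classical in
theorem step_decide (hv : Valid T q rd a b) (h : loc c p = .decide v) :
    state (next inp c (.step p)) = state c ∧
      (∀ i, announced (next inp c (.step p)) i = announced c i) ∧
      loc (next inp c (.step p)) p =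
        if state c = T.next q b ∨ state c = T.next (T.next q b) a
          then (if p = 0 then .adopt v else .done v)
          else if p = 0 then .done v else .adopt v := by
  obtain ⟨h1, h2, h3⟩ := apply_step_access (alg := alg T q rd a b V) (inp := inp) (p := p) (c := c)
    ((congrArg _ h).trans rfl)
  refine ⟨(congrFun h1 _).trans ((Function.update_self ..).trans (hv.next_read _)),
    fun i => congrFun h2 _, (congrFun h3 p).trans ((Function.update_self ..).trans ?_)⟩
  simp only [← hv.resp_read]
  rfl

theorem step_adopt (h : loc c p = .adopt v) :
    state (next inp c (.step p)) = state c ∧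
      (∀ i, announced (next inp c (.step p)) i = announced c i) ∧
      loc (next inp c (.step p)) p = .done ((announced c (if p = 0 then 1 else 0)).getD v) := by
  obtain ⟨h1, h2, h3⟩ := apply_step_read (alg := alg T q rd a b V) (inp := inp) (p := p) (c := c)
    ((congrArg _ h).trans rfl)
  exact ⟨congrFun h1 _, fun i => congrFun h2 _,
    (congrFun h3 p).trans (Function.update_self ..)⟩

theorem step_done (h : loc c p = .done v) : next inp c (.step p) = c :=
  apply_step_output (v := v) ((congrArg _ h).trans rfl)

theorem outputs_iff {w : V} : (alg T q rd a b V).Outputs c p w ↔ loc c p = .done w := by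
  change (alg T q rd a b V).code p (loc c p) = _ ↔ _
  cases h : loc c p <;> simp [alg]

end Transitions

/-- A bound on the number of steps until a run terminates. -/
def Loc.rank : Loc V → ℕ
  | .announce _ => 6
  | .look _ => 5
  | .check _ => 4
  | .update _ => 3
  | .decide _ => 2
  | .adopt _ => 1
  | .done _ => 0

theorem waitFree (hv : Valid T q rd a b) (E : Set (Event 2)) : (alg T q rd a b V).WaitFree E := by
  refine waitFree_of_rank (fun _ => Loc.rank) (fun inp c p => ?_) E
  change _ ∨ Loc.rank (loc (next inp c (.step p)) p) < Loc.rank (loc c p)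
  cases h : loc c p with
  | done v => exact .inl ⟨v, outputs_iff.mpr h⟩
  | announce v => rw [(step_announce h).2.2]; simp [Loc.rank]
  | look v => rw [(step_look hv h).2.2]; right; split_ifs <;> simp [Loc.rank]
  | check v => rw [(step_check h).2.2]; right; cases announced c 0 <;> simp [Loc.rank]
  | update v => rw [(step_update h).2.2]; simp [Loc.rank]
  | decide v => rw [(step_decide hv h).2.2]; right; split_ifs <;> simp [Loc.rank]
  | adopt v => rw [(step_adopt h).2.2]; simp [Loc.rank]

/-! ### The three phases of an execution and their invariance. -/

/-- No operation that decides the outcome has been performed, and participant `1` may still do so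
first: either the other participant has not announced its input, or participant `1` is already about
to apply its operation. -/
def Undecided (inp : Fin 2 → V) (c : (alg T q rd a b V).Config) : Prop :=
  state c = q ∧
    (announced c 0 = none ∧ loc c 0 = .announce (inp 0) ∨
      announced c 0 = some (inp 0) ∧ loc c 1 = .update (inp 1) ∧
        (loc c 0 = .announce (inp 0) ∨ loc c 0 = .look (inp 0) ∨ loc c 0 = .update (inp 0))) ∧
    (loc c 1 = .announce (inp 1) ∨ announced c 1 = some (inp 1) ∧
      (loc c 1 = .look (inp 1) ∨ loc c 1 = .check (inp 1) ∨ loc c 1 = .update (inp 1)))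

/-- The input of participant `0` is bound to be the decision. -/
def DecidedZero (inp : Fin 2 → V) (c : (alg T q rd a b V).Config) : Prop :=
  announced c 0 = some (inp 0) ∧
    -- A pending `b` is harmless after `a`, but in state `q` it could still come first, and after
    -- `a`, `b` it would be a second application of `b`.
    (state c = T.next q a ∨
      (state c = q ∨ state c = T.next (T.next q a) b) ∧ loc c 1 ≠ .update (inp 1)) ∧
    (loc c 0 = .announce (inp 0) ∨ loc c 0 = .look (inp 0) ∨
      loc c 0 = .update (inp 0) ∧ state c = q ∨ loc c 0 = .decide (inp 0) ∨
      loc c 0 = .done (inp 0)) ∧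
    (loc c 1 = .announce (inp 1) ∨ loc c 1 = .look (inp 1) ∨ loc c 1 = .check (inp 1) ∨
      loc c 1 = .update (inp 1) ∨ loc c 1 = .decide (inp 1) ∨ loc c 1 = .adopt (inp 1) ∨
      loc c 1 = .done (inp 0))

/-- The input of participant `1` is bound to be the decision. -/
def DecidedOne (inp : Fin 2 → V) (c : (alg T q rd a b V).Config) : Prop :=
  announced c 1 = some (inp 1) ∧
    (state c = T.next q b ∨ state c = T.next (T.next q b) a) ∧
    (loc c 0 = .announce (inp 0) ∨ loc c 0 = .look (inp 0) ∨
      loc c 0 = .update (inp 0) ∧ state c = T.next q b ∨ loc c 0 = .decide (inp 0) ∨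
      loc c 0 = .adopt (inp 0) ∨ loc c 0 = .done (inp 1)) ∧
    (loc c 1 = .announce (inp 1) ∨ loc c 1 = .look (inp 1) ∨ loc c 1 = .decide (inp 1) ∨
      loc c 1 = .done (inp 1))

variable {inp : Fin 2 → V} {c : (alg T q rd a b V).Config}

/-- As participant 0 has announced, `check` no longer leads participant 1 to `update`, so at most
one old pending `b` can follow `a`. If this returns the object to `q`, participant 0 may safely
apply `a` again after a crash. -/
theorem DecidedZero.apply (hv : Valid T q rd a b) (h : DecidedZero inp c) (e : Event 2) :
    DecidedZero inp (next inp c e) := by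
  obtain ⟨hr, hs, h0, h1⟩ := h
  have := hv.ne_a
  have := hv.ne_b
  have := hv.ne_ba
  have := hv.a_ne_b
  have := hv.a_ne_ba
  have := hv.ab_ne_b
  have := hv.ab_ne_ba
  unfold DecidedZero
  match e with
  | .crash 0 =>
    have := crash (inp := inp) (c := c) (p := 0)
    grind
  | .crash 1 =>
    have := crash (inp := inp) (c := c) (p := 1)
    grind
  | .step 0 =>
    have := step_loc_of_ne (inp := inp) (c := c) (p := 0) (p' := 1) (by decide)
    rcases h0 with h | h | ⟨h, h'⟩ | h | h
    · have := step_announce (inp := inp) h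
      grind
    · have := step_look (inp := inp) hv h
      grind
    · have := step_update (inp := inp) h
      grind
    · have := step_decide (inp := inp) hv h
      grind
    · rw [step_done h]
      grind
  | .step 1 =>
    have := step_loc_of_ne (inp := inp) (c := c) (p := 1) (p' := 0) (by decide)
    rcases h1 with h | h | h | h | h | h | h
    · have := step_announce (inp := inp) h
      grind
    · have := step_look (inp := inp) hv h
      grind
    · have := step_check (inp := inp) h
      grind
    · have := step_update (inp := inp) h
      grind
    · have := step_decide (inp := inp) hv h
      grind
    · have := step_adopt (inp := inp) h
      grind
    · rw [step_done h]
      grind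

/-- The object never returns to `q`, so nobody starts a new update; only an `a` that was already
pending can still change the state. -/
theorem DecidedOne.apply (hv : Valid T q rd a b) (h : DecidedOne inp c) (e : Event 2) :
    DecidedOne inp (next inp c e) := by
  obtain ⟨hr, hs, h0, h1⟩ := h
  have := hv.ne_b
  have := hv.ne_ba
  unfold DecidedOne
  match e with
  | .crash 0 =>
    have := crash (inp := inp) (c := c) (p := 0)
    grind
  | .crash 1 =>
    have := crash (inp := inp) (c := c) (p := 1)
    grind
  | .step 0 =>
    have := step_loc_of_ne (inp := inp) (c := c) (p := 0) (p' := 1) (by decide)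
    rcases h0 with h | h | ⟨h, h'⟩ | h | h | h
    · have := step_announce (inp := inp) h
      grind
    · have := step_look (inp := inp) hv h
      grind
    · have := step_update (inp := inp) h
      grind
    · have := step_decide (inp := inp) hv h
      grind
    · have := step_adopt (inp := inp) h
      grind
    · rw [step_done h]
      grind
  | .step 1 =>
    have := step_loc_of_ne (inp := inp) (c := c) (p := 1) (p' := 0) (by decide)
    rcases h1 with h | h | h | h
    · have := step_announce (inp := inp) h
      grind
    · have := step_look (inp := inp) hv h
      grind
    · have := step_decide (inp := inp) hv h
      grind
    · rw [step_done h]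
      grind

/-- Participant 1 wins by applying `b` in state `q`. Participant 0 wins by applying `a`, by
announcing while no `b` is pending, or when participant 1 crashes with `b` pending after that
announcement. -/
theorem Undecided.apply (hv : Valid T q rd a b) (h : Undecided inp c) (e : Event 2) :
    Undecided inp (next inp c e) ∨ DecidedZero inp (next inp c e) ∨
      DecidedOne inp (next inp c e) := by
  obtain ⟨hs, h0, h1⟩ := h
  unfold Undecided DecidedZero DecidedOne
  match e with
  | .crash 0 =>
    have := crash (inp := inp) (c := c) (p := 0)
    grind
  | .crash 1 =>
    have := crash (inp := inp) (c := c) (p := 1)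
    grind
  | .step 0 =>
    have := step_loc_of_ne (inp := inp) (c := c) (p := 0) (p' := 1) (by decide)
    have hl : loc c 0 = .announce (inp 0) ∨ loc c 0 = .look (inp 0) ∨
      loc c 0 = .update (inp 0) := by grind
    rcases hl with h | h | h
    · have := step_announce (inp := inp) h
      grind
    · have := step_look (inp := inp) hv h
      grind
    · have := step_update (inp := inp) h
      grind
  | .step 1 =>
    have := step_loc_of_ne (inp := inp) (c := c) (p := 1) (p' := 0) (by decide)
    rcases h1 with h | ⟨hr, h | h | h⟩
    · have := step_announce (inp := inp) h
      grind
    · have := step_look (inp := inp) hv h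
      grind
    · have := step_check (inp := inp) h
      grind
    · have := step_update (inp := inp) h
      grind

theorem DecidedZero.exec (hv : Valid T q rd a b) (h : DecidedZero inp c) (es : List (Event 2)) :
    DecidedZero inp ((alg T q rd a b V).exec inp c es) := by
  induction es generalizing c with
  | nil => exact h
  | cons e es ih => exact ih (h.apply hv e)

theorem DecidedOne.exec (hv : Valid T q rd a b) (h : DecidedOne inp c) (es : List (Event 2)) :
    DecidedOne inp ((alg T q rd a b V).exec inp c es) := by
  induction es generalizing c with
  | nil => exact h
  | cons e es ih => exact ih (h.apply hv e)

theorem Undecided.exec (hv : Valid T q rd a b) (h : Undecided inp c) (es : List (Event 2)) :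
    Undecided inp ((alg T q rd a b V).exec inp c es) ∨
      DecidedZero inp ((alg T q rd a b V).exec inp c es) ∨
      DecidedOne inp ((alg T q rd a b V).exec inp c es) := by
  induction es generalizing c with
  | nil => exact .inl h
  | cons e es ih =>
    rcases h.apply hv e with h | h | h
    exacts [ih h, .inr (.inl (h.exec hv es)), .inr (.inr (h.exec hv es))]

theorem undecided_init (inp : Fin 2 → V) :
    Undecided inp ((alg T q rd a b V).initConfig inp) :=
  ⟨rfl, .inl ⟨rfl, rfl⟩, .inl rfl⟩

theorem Undecided.not_outputs (h : Undecided inp c) {p : Fin 2} {v : V} :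
    ¬ (alg T q rd a b V).Outputs c p v := by
  rw [outputs_iff]
  obtain ⟨-, h0, h1⟩ := h
  match p with
  | 0 => grind
  | 1 => grind

theorem DecidedZero.eq_of_outputs (h : DecidedZero inp c) {p : Fin 2} {v : V}
    (hp : (alg T q rd a b V).Outputs c p v) : v = inp 0 := by
  rw [outputs_iff] at hp
  obtain ⟨-, -, h0, h1⟩ := h
  match p with
  | 0 => grind
  | 1 => grind

theorem DecidedOne.eq_of_outputs (h : DecidedOne inp c) {p : Fin 2} {v : V}
    (hp : (alg T q rd a b V).Outputs c p v) : v = inp 1 := by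
  rw [outputs_iff] at hp
  obtain ⟨-, -, h0, h1⟩ := h
  match p with
  | 0 => grind
  | 1 => grind

theorem solvesRC (hv : Valid T q rd a b) : (alg T q rd a b V).SolvesRC := by
  refine ⟨fun inp es es' _ p p' v v' hp hp' => ?_, fun inp es _ p v hp => ?_, waitFree hv _⟩
  · rw [exec_append] at hp'
    rcases (undecided_init inp).exec hv es with h | h | h
    · exact (h.not_outputs hp).elim
    · rw [h.eq_of_outputs hp, (h.exec hv es').eq_of_outputs hp']
    · rw [h.eq_of_outputs hp, (h.exec hv es').eq_of_outputs hp']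
  · rcases (undecided_init inp).exec hv es with h | h | h
    · exact (h.not_outputs hp).elim
    · exact ⟨0, (h.eq_of_outputs hp).symm⟩
    · exact ⟨1, (h.eq_of_outputs hp).symm⟩

end RecoverablePair

/-! ### Recoverable consensus from a recording type, and the two consensus numbers. -/

namespace ObjType

variable {T : ObjType.{u}}

/-- Disjointness lets `q` lie in at most one of the two sets, and that team is given the role of
`a`. Moreover `a` cannot fix `q`, since otherwise `a` followed by `b` would reach the same state as
`b` alone. -/
theorem Recording.exists_valid (h : T.Recording 2) (hT : T.Readable) :
    ∃ q rd a b, RecoverablePair.Valid T q rd a b := by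
  obtain ⟨rd, hrd, hinj⟩ := hT
  obtain ⟨q, A, B, op, ⟨⟨i, hi⟩, ⟨j, hj⟩, hAB, -⟩, hdisj, -⟩ := h
  have hij : i ≠ j := fun e => Finset.disjoint_left.mp hAB hi (e ▸ hj)
  have h1 : ∀ {X i}, i ∈ X → T.next q (op i) ∈ T.recordSet q op X := fun {X i} hi =>
    ⟨[i], by simp, ⟨i, hi, rfl⟩, rfl⟩
  have h2 : ∀ {X i j}, i ∈ X → i ≠ j → T.next (T.next q (op i)) (op j) ∈ T.recordSet q op X :=
    fun {X i j} hi hij => ⟨[i, j], by simp [hij], ⟨i, hi, rfl⟩, rfl⟩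
  have hne : ∀ {s s'}, s ∈ T.recordSet q op A → s' ∈ T.recordSet q op B → s ≠ s' := by
    rintro s _ hs hs' rfl
    exact (Set.eq_empty_iff_forall_notMem.mp hdisj) s ⟨hs, hs'⟩
  have e1 := hne (h1 hi) (h1 hj)
  have e2 := hne (h1 hi) (h2 hj hij.symm)
  have e3 := hne (h2 hi hij) (h1 hj)
  have e4 := hne (h2 hi hij) (h2 hj hij.symm)
  have hresp : ∀ s s', T.resp s rd = T.resp s' rd ↔ s = s' := fun s s' => hinj.eq_iff
  by_cases hq : q ∈ T.recordSet q op B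
  -- The roles are swapped, so that `q` is not reachable when `b` comes first.
  · refine ⟨q, rd, op j, op i, hrd, hresp, ?_, (hne (h1 hi) hq).symm, (hne (h2 hi hij) hq).symm,
      e1.symm, e3.symm, e2.symm, e4.symm⟩
    intro e
    rw [← e] at e4 e3 e2 e1
    exact e2 rfl
  · refine ⟨q, rd, op i, op j, hrd, hresp, ?_, fun e => hq (Eq.mpr (congrArg (· ∈ _) e) (h1 hj)),
      fun e => hq (Eq.mpr (congrArg (· ∈ _) e) (h2 hj hij.symm)), e1, e2, e3, e4⟩
    intro e
    rw [← e] at e3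
    exact e3 rfl

theorem Recording.canSolveRC (h : T.Recording 2) (hT : T.Readable) : T.CanSolveRC 2 := by
  obtain ⟨q, rd, a, b, hv⟩ := h.exists_valid hT
  exact fun V => ⟨_, RecoverablePair.solvesRC hv⟩

theorem CanSolveRC.canSolveConsensus {n : ℕ} (h : T.CanSolveRC n) : T.CanSolveConsensus n :=
  fun V => (h V).imp fun _ hs => hs.mono (Set.subset_univ _)

theorem rcons_le_cons (T : ObjType.{u}) : T.rcons ≤ T.cons :=
  biSup_mono fun _ h => CanSolveRC.canSolveConsensus h

/-- A positive finite consensus number is attained. -/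
theorem canSolveConsensus_of_cons_eq {n : ℕ} (h : T.cons = (n + 1 : ℕ)) :
    T.CanSolveConsensus (n + 1) := by
  by_contra hn
  -- If `n + 1` were not attained, every attained value would be at most `n`, and so would the
  -- supremum.
  have : T.cons ≤ (n : ℕ∞) := iSup₂_le fun m hm => by
    have h1 : (m : ℕ∞) ≤ T.cons := le_iSup₂ (f := fun (m : ℕ) _ => (m : ℕ∞)) m hm
    rw [h, Nat.cast_le] at h1
    have : m ≠ n + 1 := fun e => hn (e ▸ hm)
    exact Nat.cast_le.mpr (by omega)
  rw [h, Nat.cast_le] at this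
  omega

end ObjType

theorem proposition6 (T : ObjType.{u}) (hT : T.Readable) :
    (T.Discerning 3 → T.Recording 2) ∧
      (T.cons = 3 → 2 ≤ T.rcons ∧ T.rcons ≤ 3) := by
  refine ⟨ObjType.Discerning.recording_two, fun h => ⟨?_, h ▸ T.rcons_le_cons⟩⟩
  have h3 : T.CanSolveConsensus 3 :=
    ObjType.canSolveConsensus_of_cons_eq (n := 2) (by simpa using h)
  have h2 : T.CanSolveRC 2 := (h3.discerning (by norm_num)).recording_two.canSolveRC hT
  exact le_iSup₂ (f := fun (m : ℕ) (_ : m ∈ {n | T.CanSolveRC n}) => (m : ℕ∞)) 2 h2
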